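/- Setting (Online Network Formation Problem). Finitely many point robots, with pairwise distinct identifiers, are placed at arbitrary points of the plane $\mathbb{R}^2$. One of them, the leader, is active; all others are asleep. The unit of length is the communication range, which is also the largest distance a robot can move in one time step. Time is discrete; sleeping robots do not move, and in each time step every active robot moves by at most $1$. At every time $t=0,1,2,\dots$, every sleeping robot at distance at most $1$ from an active robot becomes active at once (and then awakens its own neighbours in the same way). The cost of a motion of the robots is the first time at which all robots are active. For a deployment $\sigma$, $OPT(\sigma)$ is the smallest cost of any such motion, planned with full knowledge of all positions. An online algorithm is a deterministic program that is run by every active robot: a robot that wakes up knows only its own identifier, whether it is the leader, and its own position (in a common coordinate frame), and in each time step its next internal state and its displacement are determined by its own identifier, position and state and those of the active robots within distance $1$ of it. $A(\sigma)$ denotes the cost of the motion that the algorithm $A$ produces on $\sigma$. Theorem. There are an online algorithm $A$ and an absolute constant $C$ such that for every deployment $\sigma$, every Euclidean minimum spanning tree $\mathcal T$ of the initial positions and every choice of a root of $\mathcal T$, $A$ tags all robots in finite time and $$A(\sigma)\;\le\; C\cdot H\cdot\max\{M,\sqrt{MH}\}\cdot OPT(\sigma),$$ where $M$ is the length of the longest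 edge of $\mathcal T$ ($0$ if there is no edge) and $H$ is the height of the rooted tree $\mathcal T$, that is, the largest number of edges on a path from the root. In other words, there is an $O(H\cdot\max\{M,\sqrt{MH}\})$-competitive algorithm for the Online Network Formation Problem for arbitrary deployments in the unbounded plane. -/

import Mathlib

open scoped NNReal ENNReal

namespace ONFP

/-- The unbounded planar environment, with the Euclidean distance. The unit of length is the
communication range, which is also the distance that a robot can cover in one time step. -/
abbrev Plane : Type := EuclideanSpace ℝ (Fin 2)

/-- An instance: `n + 1` point robots at arbitrary initial positions (coincidences allowed), carrying
arbitrary distinct identifiers. Robot `0` is the leader, the only one active at the beginning. -/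
structure Deployment where
  n : ℕ
  pos : Fin (n + 1) → Plane
  ident : Fin (n + 1) → ℕ
  ident_injective : Function.Injective ident

section Awakening

variable {ι : Type}

/-- The robots that are active once every robot within distance `1` of an active one has been
awakened, when the robots stand at `p` and those in `S` are active. A robot awakened
in this way is active, and awakens its own neighbours. -/
def awaken (p : ι → Plane) (S : Set ι) : Set ι :=
  {j | ∃ i ∈ S, Relation.ReflTransGen (fun a b => dist (p a) (p b) ≤ 1) i j}

/-- The robots that are active at time `t` under the motion `p` (`p t i` is the position of robot
`i` at time `t`), if only `leader` is active initially. -/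
def awakeAt (leader : ι) (p : ℕ → ι → Plane) : ℕ → Set ι
  | 0 => awaken (p 0) {leader}
  | t + 1 => awaken (p (t + 1)) (awakeAt leader p t)

/-- The time at which the last robot is tagged (`⊤` if some robot never is). -/
noncomputable def tagTime (leader : ι) (p : ℕ → ι → Plane) : ℕ∞ :=
  ⨅ (t : ℕ) (_ : awakeAt leader p t = Set.univ), (t : ℕ∞)

end Awakening

/-- The motions that are physically possible from the deployment `σ`: at most unit displacement
per time step, and sleeping robots stay put. -/
structure IsMotion (σ : Deployment) (p : ℕ → Fin (σ.n + 1) → Plane) : Prop where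
  start : p 0 = σ.pos
  speed : ∀ t i, dist (p t i) (p (t + 1) i) ≤ 1
  asleep : ∀ t i, i ∉ awakeAt 0 p t → p (t + 1) i = p t i

/-- The optimal offline time: the best motion, planned with full knowledge of the deployment. -/
noncomputable def opt (σ : Deployment) : ℕ∞ :=
  ⨅ (p : ℕ → Fin (σ.n + 1) → Plane) (_ : IsMotion σ p), tagTime 0 p

/-- What a robot tells the active robots within communication range: identifier, position
and internal state. -/
structure Report (State : Type) where
  ident : ℕ
  pos : Plane
  state : State

/-- A deterministic distributed online algorithm. Every robot runs the same program. When it becomes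
active, a robot knows its own identifier, whether it is the leader, and its own
position. In each time step an active robot computes its new state and its displacement
from its own report and the set of reports of the active robots within distance `1` of it. -/
structure OnlineAlgorithm where
  State : Type
  init : (ident : ℕ) → (isLeader : Bool) → (pos : Plane) → State
  next : (self : Report State) → (heard : Set (Report State)) → State
  move : (self : Report State) → (heard : Set (Report State)) → Plane
  norm_move_le : ∀ self heard, ‖move self heard‖ ≤ 1

/-- A global snapshot of an execution. The state of a sleeping robot is the one in which it
will wake up. -/
structure Snapshot (ι State : Type) where
  pos : ι → Plane
  awake : Set ι
  state : ι → State

namespace OnlineAlgorithm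

variable (A : OnlineAlgorithm) (σ : Deployment)

/-- The report of robot `i`. -/
def report (c : Snapshot (Fin (σ.n + 1)) A.State) (i : Fin (σ.n + 1)) : Report A.State :=
  ⟨σ.ident i, c.pos i, c.state i⟩

/-- The reports of the active robots within communication range of robot `i`. -/
def heard (c : Snapshot (Fin (σ.n + 1)) A.State) (i : Fin (σ.n + 1)) : Set (Report A.State) :=
  {m | ∃ j ∈ c.awake, dist (c.pos i) (c.pos j) ≤ 1 ∧ m = A.report σ c j}

open Classical in
/-- The positions of the robots after one more time step. -/
noncomputable def nextPos (c : Snapshot (Fin (σ.n + 1)) A.State) : Fin (σ.n + 1) → Plane :=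
  fun i => if i ∈ c.awake then c.pos i + A.move (A.report σ c i) (A.heard σ c i) else c.pos i

open Classical in
/-- The execution of the algorithm on the deployment `σ`. -/
noncomputable def run : ℕ → Snapshot (Fin (σ.n + 1)) A.State
  | 0 =>
    { pos := σ.pos
      awake := awaken σ.pos {0}
      state := fun i => A.init (σ.ident i) (decide (i = 0)) (σ.pos i) }
  | t + 1 =>
    { pos := A.nextPos σ (run t)
      awake := awaken (A.nextPos σ (run t)) (run t).awake
      state := fun i =>
        if i ∈ (run t).awake then
          A.next (A.report σ (run t) i) (A.heard σ (run t) i)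
        else (run t).state i }

/-- The motion of the robots in the execution. -/
noncomputable def motion (t : ℕ) : Fin (σ.n + 1) → Plane := (A.run σ t).pos

theorem awakeAt_motion (t : ℕ) : awakeAt 0 (A.motion σ) t = (A.run σ t).awake := by
  induction t with
  | zero => rfl
  | succ t ih => simp only [awakeAt, ih]; rfl

/-- The execution of an online algorithm is a physically possible motion. -/
theorem isMotion_motion : IsMotion σ (A.motion σ) where
  start := rfl
  speed t i := by
    change dist ((A.run σ t).pos i) (A.nextPos σ (A.run σ t) i) ≤ 1
    unfold nextPos
    split_ifs
    · simpa using A.norm_move_le _ _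
    · simp
  asleep t i hi := by
    rw [awakeAt_motion] at hi
    change A.nextPos σ (A.run σ t) i = (A.run σ t).pos i
    simp [nextPos, hi]

/-- The time that the algorithm needs to tag all robots. -/
noncomputable def cost : ℕ∞ := tagTime 0 (A.motion σ)

end OnlineAlgorithm

section MinimumSpanningTree

variable {ι : Type} [Fintype ι] (x : ι → Plane)

/-- The Euclidean length of an edge, for vertices placed at `x`. -/
noncomputable def edgeLength (e : Sym2 ι) : ℝ≥0 :=
  Sym2.lift ⟨fun i j => nndist (x i) (x j), fun i j => nndist_comm (x i) (x j)⟩ e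

open Classical in
/-- The total edge length of a graph on the vertices. -/
noncomputable def totalLength (T : SimpleGraph ι) : ℝ≥0 :=
  ∑ e ∈ T.edgeFinset, edgeLength x e

/-- `T` is a Euclidean minimum spanning tree of the points `x`. -/
def IsMST (T : SimpleGraph ι) : Prop :=
  T.IsTree ∧ ∀ T' : SimpleGraph ι, T'.IsTree → totalLength x T ≤ totalLength x T'

open Classical in
/-- The length of the longest edge (`0` if there is no edge). -/
noncomputable def longestEdge (T : SimpleGraph ι) : ℝ≥0 :=
  T.edgeFinset.sup (edgeLength x)

/-- The height of `T` as a tree rooted at `root`: the largest number of edges on a path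
from the root. -/
noncomputable def height (T : SimpleGraph ι) (root : ι) : ℕ :=
  Finset.univ.sup (fun v => T.dist root v)

end MinimumSpanningTree

end ONFP

namespace ONFP

/-! Every active robot walks a square spiral around its starting point. Within `O(R ^ 2)` steps (`R
≥ 1`) it passes within distance `1` of every point at distance at most `R`, so a wake-up crosses a
tree edge in `O(M ^ 2)` time (`spiralSearch_awakens`). Tree paths from the leader have at most `2 *
H` edges, which gives cost `O(H * M ^ 2)` if `M ≥ 1` (`cost_spiralSearch_le`). Conversely, removing
a longest edge of the minimum spanning tree leaves two sides at distance at least `M`, so the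
optimum is at least `M / 2` when `M > 1` (`longestEdge_le_two_mul_opt`). This absorbs one factor
`M`, and the ratio is `O(H * M)`. If `M ≤ 1`, everyone is active at time `0`. -/

/-! ### The square spiral -/

/-- The successor of a lattice point on the counterclockwise square spiral around the origin. -/
def spiralStep (p : ℤ × ℤ) : ℤ × ℤ :=
  if p.1 ≤ -p.2 ∧ p.2 ≤ p.1 then (p.1 + 1, p.2)
  else if p.2 < p.1 then (p.1, p.2 + 1)
  else if -p.2 < p.1 then (p.1 - 1, p.2)
  else (p.1, p.2 - 1)

/-- The square spiral through all lattice points, from the origin. -/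
def spiral (n : ℕ) : ℤ × ℤ := spiralStep^[n] (0, 0)

theorem spiral_succ (n : ℕ) : spiral (n + 1) = spiralStep (spiral n) :=
  Function.iterate_succ_apply' _ _ _

theorem spiral_add_segment {s : ℕ} {p d : ℤ × ℤ} {l : ℕ} (hs : spiral s = p)
    (hstep : ∀ j < l, spiralStep (p + j • d) = p + (j + 1) • d) :
    ∀ j ≤ l, spiral (s + j) = p + j • d := by
  intro j
  induction j with
  | zero => simp [hs]
  | succ j ih =>
    intro hj
    rw [← add_assoc, spiral_succ, ih (by omega), hstep j (by omega)]

/-- The step out of the corner `(m, -m)` leads to the next ring, so this side starts one step later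
and is one step shorter than the other sides of that ring. -/
theorem spiral_right_side {s m : ℕ} (hs : spiral s = ((m : ℤ), -(m : ℤ))) :
    ∀ j ≤ 2 * m + 1, spiral (s + 1 + j) = ((m : ℤ) + 1, -(m : ℤ) + j) := by
  have h0 : spiral (s + 1) = ((m : ℤ) + 1, -(m : ℤ)) := by
    rw [spiral_succ, hs]; simp [spiralStep]
  intro j hj
  rw [spiral_add_segment (d := (0, 1)) (l := 2 * m + 1) h0 _ j hj]
  · simp
  · intro j hj
    simp only [spiralStep, Prod.smul_mk, Prod.mk_add_mk, smul_zero, nsmul_eq_mul, mul_one,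
      add_zero]
    rw [if_neg (by omega), if_pos (by omega)]
    ext <;> simp; omega

theorem spiral_top_side {s m : ℕ} (hs : spiral s = ((m : ℤ), (m : ℤ))) :
    ∀ j ≤ 2 * m, spiral (s + j) = ((m : ℤ) - j, (m : ℤ)) := by
  intro j hj
  rw [spiral_add_segment (d := (-1, 0)) (l := 2 * m) hs _ j hj]
  · ext <;> simp; omega
  · intro j hj
    simp only [spiralStep, Prod.smul_mk, Prod.mk_add_mk, smul_zero, nsmul_eq_mul, mul_neg, mul_one,
      add_zero]
    rw [if_neg (by omega), if_neg (by omega), if_pos (by omega)]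
    ext <;> simp; omega

theorem spiral_left_side {s m : ℕ} (hs : spiral s = (-(m : ℤ), (m : ℤ))) :
    ∀ j ≤ 2 * m, spiral (s + j) = (-(m : ℤ), (m : ℤ) - j) := by
  intro j hj
  rw [spiral_add_segment (d := (0, -1)) (l := 2 * m) hs _ j hj]
  · ext <;> simp; omega
  · intro j hj
    simp only [spiralStep, Prod.smul_mk, Prod.mk_add_mk, smul_zero, nsmul_eq_mul, mul_neg, mul_one,
      add_zero]
    rw [if_neg (by omega), if_neg (by omega), if_neg (by omega)]
    ext <;> simp; omega

theorem spiral_bottom_side {s m : ℕ} (hs : spiral s = (-(m : ℤ), -(m : ℤ))) :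
    ∀ j ≤ 2 * m, spiral (s + j) = (-(m : ℤ) + j, -(m : ℤ)) := by
  intro j hj
  rw [spiral_add_segment (d := (1, 0)) (l := 2 * m) hs _ j hj]
  · simp
  · intro j hj
    simp only [spiralStep, Prod.smul_mk, Prod.mk_add_mk, smul_zero, nsmul_eq_mul, mul_one,
      add_zero]
    rw [if_pos (by omega)]
    ext <;> simp; omega

theorem spiral_corners {s m : ℕ} (hs : spiral s = ((m : ℤ), -(m : ℤ))) :
    spiral (s + 1 + (2 * m + 1)) = (((m + 1 : ℕ) : ℤ), ((m + 1 : ℕ) : ℤ)) ∧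
    spiral (s + 1 + (2 * m + 1) + 2 * (m + 1)) = (-((m + 1 : ℕ) : ℤ), ((m + 1 : ℕ) : ℤ)) ∧
    spiral (s + 1 + (2 * m + 1) + 2 * (m + 1) + 2 * (m + 1)) =
      (-((m + 1 : ℕ) : ℤ), -((m + 1 : ℕ) : ℤ)) ∧
    spiral (s + 1 + (2 * m + 1) + 2 * (m + 1) + 2 * (m + 1) + 2 * (m + 1)) =
      (((m + 1 : ℕ) : ℤ), -((m + 1 : ℕ) : ℤ)) := by
  have h1 : spiral (s + 1 + (2 * m + 1)) = (((m + 1 : ℕ) : ℤ), ((m + 1 : ℕ) : ℤ)) := by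
    rw [spiral_right_side hs _ le_rfl]; ext <;> simp; omega
  have h2 : spiral (s + 1 + (2 * m + 1) + 2 * (m + 1)) =
      (-((m + 1 : ℕ) : ℤ), ((m + 1 : ℕ) : ℤ)) := by
    rw [spiral_top_side h1 _ le_rfl]; ext <;> simp; omega
  have h3 : spiral (s + 1 + (2 * m + 1) + 2 * (m + 1) + 2 * (m + 1)) =
      (-((m + 1 : ℕ) : ℤ), -((m + 1 : ℕ) : ℤ)) := by
    rw [spiral_left_side h2 _ le_rfl]; ext <;> simp; omega
  refine ⟨h1, h2, h3, ?_⟩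
  rw [spiral_bottom_side h3 _ le_rfl]; ext <;> simp; omega

/-- By this time exactly the `(2 * m + 1) ^ 2` lattice points of the square of radius `m` have been
visited. -/
theorem spiral_corner (m : ℕ) : spiral (4 * m * (m + 1)) = ((m : ℤ), -(m : ℤ)) := by
  induction m with
  | zero => simp [spiral]
  | succ m ih =>
    convert (spiral_corners ih).2.2.2 using 2
    ring

theorem exists_spiral_eq (p : ℤ × ℤ) (m : ℕ) (h1 : |p.1| ≤ m) (h2 : |p.2| ≤ m) :
    ∃ k ≤ 4 * m * (m + 1), spiral k = p := by
  obtain ⟨x, y⟩ := p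
  simp only [abs_le] at h1 h2
  induction m with
  | zero =>
    refine ⟨0, by simp, ?_⟩
    ext <;> simp [spiral] <;> push_cast at h1 h2 <;> omega
  | succ m ih =>
    have e : 4 * (m + 1) * (m + 1 + 1) = 4 * m * (m + 1) + 8 * m + 8 := by ring
    rw [e]
    by_cases hin : (-(m : ℤ) ≤ x ∧ x ≤ m) ∧ (-(m : ℤ) ≤ y ∧ y ≤ m)
    · obtain ⟨k, hk, h⟩ := ih hin.1 hin.2
      exact ⟨k, by omega, h⟩
    · have hs := spiral_corner m
      obtain ⟨c1, c2, c3, -⟩ := spiral_corners hs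
      push_cast at h1 h2
      generalize 4 * m * (m + 1) = s at *
      by_cases hr : x = m + 1 ∧ -(m : ℤ) ≤ y
      · refine ⟨_, ?_, (spiral_right_side hs (y + m).toNat (by omega)).trans ?_⟩
        · omega
        · ext <;> simp <;> omega
      by_cases ht : y = m + 1
      · refine ⟨_, ?_, (spiral_top_side c1 (m + 1 - x).toNat (by omega)).trans ?_⟩
        · omega
        · ext <;> simp <;> omega
      by_cases hl : x = -(m + 1)
      · refine ⟨_, ?_, (spiral_left_side c2 (m + 1 - y).toNat (by omega)).trans ?_⟩
        · omega
        · ext <;> simp <;> omega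
      · refine ⟨_, ?_, (spiral_bottom_side c3 (m + 1 + x).toNat (by omega)).trans ?_⟩
        · omega
        · ext <;> simp <;> omega

/-- The inclusion of the integer lattice into the plane. -/
noncomputable def latticePoint (p : ℤ × ℤ) : Plane := !₂[(p.1 : ℝ), (p.2 : ℝ)]

theorem latticePoint_zero : latticePoint (0, 0) = 0 := by
  ext i; fin_cases i <;> simp [latticePoint]

theorem norm_latticePoint_spiralStep_sub_le (p : ℤ × ℤ) :
    ‖latticePoint (spiralStep p) - latticePoint p‖ ≤ 1 := by
  rw [EuclideanSpace.norm_eq, Real.sqrt_le_one]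
  simp only [Fin.sum_univ_two, latticePoint, spiralStep]
  split_ifs <;> simp

/-- Rounding both coordinates moves `x` by at most `√(1/2)`. The rounded point lies in the square of
radius `m ≤ R + 1/2`, and `4 * m * (m + 1) ≤ 4 * R ^ 2 + 8 * R + 3 ≤ 16 * R ^ 2` as `R ≥ 1`. -/
theorem exists_dist_spiral_le_one (x : Plane) {R : ℝ} (hR : 1 ≤ R) (hx : ‖x‖ ≤ R) :
    ∃ k : ℕ, (k : ℝ) ≤ 16 * R ^ 2 ∧ dist (latticePoint (spiral k)) x ≤ 1 := by
  have hcoord : ∀ i, |x i| ≤ R := fun i =>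
    ((Real.norm_eq_abs _).symm.le.trans (PiLp.norm_apply_le x i)).trans hx
  have hround : ∀ i, |x i - round (x i)| ≤ 1 / 2 := fun i => abs_sub_round _
  have hbound : ∀ i, |round (x i)| ≤ (⌊R + 1 / 2⌋₊ : ℤ) := by
    intro i
    have h := Nat.le_floor (n := (round (x i)).natAbs) (a := R + 1 / 2) (by
      rw [Nat.cast_natAbs, Int.cast_abs]
      have h1 := abs_le.1 (hcoord i)
      have h2 := abs_le.1 (hround i)
      exact abs_le.2 ⟨by linarith, by linarith⟩)
    rw [Int.abs_eq_natAbs]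
    exact_mod_cast h
  obtain ⟨k, hk, e⟩ := exists_spiral_eq (round (x 0), round (x 1)) _ (hbound 0) (hbound 1)
  refine ⟨k, ?_, ?_⟩
  · have hm : (⌊R + 1 / 2⌋₊ : ℝ) ≤ R + 1 / 2 := Nat.floor_le (by linarith)
    have hk' : (k : ℝ) ≤ 4 * ⌊R + 1 / 2⌋₊ * (⌊R + 1 / 2⌋₊ + 1) := by exact_mod_cast hk
    have h0 : (0 : ℝ) ≤ ⌊R + 1 / 2⌋₊ := Nat.cast_nonneg _
    nlinarith
  · rw [e, EuclideanSpace.dist_eq, Real.sqrt_le_one]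
    simp only [Fin.sum_univ_two, latticePoint, Real.dist_eq, sq_abs]
    have a := abs_le.1 (hround 0)
    have b := abs_le.1 (hround 1)
    simp only [Matrix.cons_val_zero, Matrix.cons_val_one]
    nlinarith

/-! ### Awakening and the spiral search -/

theorem subset_awaken {ι : Type} (p : ι → Plane) (S : Set ι) : S ⊆ awaken p S :=
  fun i hi => ⟨i, hi, .refl⟩

theorem mem_awaken_of_dist_le {ι : Type} {p : ι → Plane} {S : Set ι} {i j : ι}
    (hi : i ∈ awaken p S) (h : dist (p i) (p j) ≤ 1) : j ∈ awaken p S := by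
  obtain ⟨k, hk, hki⟩ := hi
  exact ⟨k, hk, hki.tail h⟩

theorem awaken_subset {ι : Type} {p : ι → Plane} {S V : Set ι} (hS : S ⊆ V)
    (hV : ∀ i ∈ V, ∀ j ∉ V, 1 < dist (p i) (p j)) : awaken p S ⊆ V := by
  rintro j ⟨i, hi, hij⟩
  induction hij with
  | refl => exact hS hi
  | tail _ h ih =>
    by_contra hj
    exact (hV _ ih _ hj).not_ge h

theorem tagTime_le {ι : Type} {leader : ι} {p : ℕ → ι → Plane} {t : ℕ}
    (h : awakeAt leader p t = Set.univ) : tagTime leader p ≤ t :=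
  iInf₂_le t h

/-- Every active robot searches the plane along a square spiral around its initial position. Its
state is the offset from that position. -/
noncomputable def spiralSearch : OnlineAlgorithm where
  State := ℤ × ℤ
  init _ _ _ := (0, 0)
  next self _ := spiralStep self.state
  move self _ := latticePoint (spiralStep self.state) - latticePoint self.state
  norm_move_le self _ := norm_latticePoint_spiralStep_sub_le self.state

namespace OnlineAlgorithm

variable (A : OnlineAlgorithm) (σ : Deployment)

theorem run_awake_mono : Monotone fun t => (A.run σ t).awake :=
  monotone_nat_of_le_succ fun _ => subset_awaken _ _

theorem mem_run_awake_of_dist_le {t : ℕ} {i j : Fin (σ.n + 1)} (hi : i ∈ (A.run σ t).awake)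
    (h : dist ((A.run σ t).pos i) ((A.run σ t).pos j) ≤ 1) : j ∈ (A.run σ t).awake := by
  cases t with
  | zero => exact mem_awaken_of_dist_le hi h
  | succ t => exact mem_awaken_of_dist_le hi h

theorem run_of_forall_notMem {i : Fin (σ.n + 1)} {t : ℕ}
    (h : ∀ s < t, i ∉ (A.run σ s).awake) :
    (A.run σ t).pos i = σ.pos i ∧
      (A.run σ t).state i = A.init (σ.ident i) (decide (i = 0)) (σ.pos i) := by
  induction t with
  | zero => exact ⟨rfl, rfl⟩
  | succ t ih =>
    have ht := h t t.lt_succ_self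
    obtain ⟨h1, h2⟩ := ih fun s hs => h s (hs.trans t.lt_succ_self)
    simp [run, nextPos, ht, h1, h2]

theorem run_pos_of_notMem {i : Fin (σ.n + 1)} {t : ℕ} (h : i ∉ (A.run σ t).awake) :
    (A.run σ t).pos i = σ.pos i :=
  (A.run_of_forall_notMem σ fun _ hs hi => h (A.run_awake_mono σ hs.le hi)).1

theorem cost_le {t : ℕ} (h : ∀ i, i ∈ (A.run σ t).awake) : A.cost σ ≤ t :=
  tagTime_le (by rw [awakeAt_motion]; exact Set.eq_univ_of_forall h)

end OnlineAlgorithm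

open OnlineAlgorithm

variable (σ : Deployment)

/-- The witness `s` is the first time at which `i` is active; from then on its offset depends only
on the time elapsed. -/
theorem exists_spiralSearch_pos_eq {i : Fin (σ.n + 1)} {t : ℕ}
    (hi : i ∈ (spiralSearch.run σ t).awake) :
    ∃ s ≤ t, ∀ k, i ∈ (spiralSearch.run σ (s + k)).awake ∧
      (spiralSearch.run σ (s + k)).pos i = σ.pos i + latticePoint (spiral k) := by
  classical
  have hex : ∃ s, i ∈ (spiralSearch.run σ s).awake := ⟨t, hi⟩
  have hs := Nat.find_spec hex
  have hstart := spiralSearch.run_of_forall_notMem σ fun s (hs : s < Nat.find hex) =>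
    Nat.find_min hex hs
  refine ⟨Nat.find hex, Nat.find_min' hex hi, ?_⟩
  generalize Nat.find hex = s at *
  have hawake : ∀ k, i ∈ (spiralSearch.run σ (s + k)).awake := fun k =>
    spiralSearch.run_awake_mono σ (Nat.le_add_right s k) hs
  have key : ∀ k, (spiralSearch.run σ (s + k)).pos i = σ.pos i + latticePoint (spiral k) ∧
      (spiralSearch.run σ (s + k)).state i = spiral k := by
    intro k
    induction k with
    | zero =>
      refine ⟨?_, hstart.2⟩
      rw [add_zero, hstart.1]
      simp [spiral, latticePoint_zero]
    | succ k ih =>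
      have hpos : (spiralSearch.run σ (s + (k + 1))).pos i =
          (spiralSearch.run σ (s + k)).pos i +
            (latticePoint (spiralStep ((spiralSearch.run σ (s + k)).state i)) -
              latticePoint ((spiralSearch.run σ (s + k)).state i)) := if_pos (hawake k)
      have hstate : (spiralSearch.run σ (s + (k + 1))).state i =
          spiralStep ((spiralSearch.run σ (s + k)).state i) := if_pos (hawake k)
      rw [hpos, hstate, ih.1, ih.2, ← spiral_succ]
      exact ⟨by abel, rfl⟩
  exact fun k => ⟨hawake k, (key k).1⟩

theorem spiralSearch_awakens {i j : Fin (σ.n + 1)} {t N : ℕ} {R : ℝ} (hR : 1 ≤ R)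
    (hN : N = ⌊16 * R ^ 2⌋₊) (hij : dist (σ.pos i) (σ.pos j) ≤ R)
    (hi : i ∈ (spiralSearch.run σ t).awake) : j ∈ (spiralSearch.run σ (t + N)).awake := by
  obtain ⟨s, hst, h⟩ := exists_spiralSearch_pos_eq σ hi
  obtain ⟨k, hk, hd⟩ := exists_dist_spiral_le_one (σ.pos j - σ.pos i) hR
    (by rwa [← dist_eq_norm, dist_comm])
  have hkN : k ≤ N := hN ▸ Nat.le_floor hk
  refine spiralSearch.run_awake_mono σ (Nat.add_le_add hst hkN) ?_
  -- A robot `j` still asleep stands at its initial position, where the spiral of `i` meets it.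
  by_contra hj
  refine hj (spiralSearch.mem_run_awake_of_dist_le σ (h k).1 ?_)
  rw [(h k).2, spiralSearch.run_pos_of_notMem σ hj]
  rw [dist_eq_norm] at hd ⊢
  convert hd using 2
  abel

/-! ### Edge exchange and cuts in minimum spanning trees -/

theorem reachable_deleteEdges_or {ι : Type} {G : SimpleGraph ι} (hG : G.Connected) (u v w : ι) :
    (G.deleteEdges {s(u, v)}).Reachable u w ∨ (G.deleteEdges {s(u, v)}).Reachable v w := by
  obtain ⟨p⟩ := hG.preconnected w u
  induction p with
  | nil => exact .inl .rfl
  | @cons a b u hab p ih =>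
    by_cases he : s(a, b) = s(u, v)
    · rcases Sym2.eq_iff.1 he with ⟨rfl, -⟩ | ⟨rfl, -⟩
      · exact .inl .rfl
      · exact .inr .rfl
    · have hba : (G.deleteEdges {s(u, v)}).Reachable b a :=
        SimpleGraph.Adj.reachable (SimpleGraph.deleteEdges_adj.2 ⟨hab, he⟩).symm
      exact ih.imp (·.trans hba) (·.trans hba)

theorem connected_deleteEdges_sup_edge {ι : Type} {G : SimpleGraph ι} (hG : G.Connected) {u v a b : ι}
    (hab : ¬ (G.deleteEdges {s(u, v)}).Reachable a b) :
    (G.deleteEdges {s(u, v)} ⊔ SimpleGraph.edge a b).Connected := by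
  set D := G.deleteEdges {s(u, v)}
  have hle : ∀ {y z}, D.Reachable y z → (D ⊔ SimpleGraph.edge a b).Reachable y z :=
    fun h => h.mono le_sup_left
  have hne : a ≠ b := fun h => hab (h ▸ .rfl)
  have hedge : (D ⊔ SimpleGraph.edge a b).Reachable a b :=
    SimpleGraph.Adj.reachable (Or.inr ((SimpleGraph.edge_adj ..).2 ⟨.inl ⟨rfl, rfl⟩, hne⟩))
  have huv : (D ⊔ SimpleGraph.edge a b).Reachable u v := by
    rcases reachable_deleteEdges_or hG u v a with ha | ha <;>
    rcases reachable_deleteEdges_or hG u v b with hb | hb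
    · exact (hab (ha.symm.trans hb)).elim
    · exact ((hle ha).trans hedge).trans (hle hb).symm
    · exact (((hle ha).trans hedge).trans (hle hb).symm).symm
    · exact (hab (ha.symm.trans hb)).elim
  have hu : ∀ w, (D ⊔ SimpleGraph.edge a b).Reachable u w := fun w =>
    (reachable_deleteEdges_or hG u v w).elim (hle ·) fun h => huv.trans (hle h)
  have : Nonempty ι := ⟨u⟩
  exact ⟨fun y z => (hu y).symm.trans (hu z)⟩

section Graph

variable {ι : Type} [Fintype ι] (x : ι → Plane) {T : SimpleGraph ι}

theorem nndist_le_longestEdge {i j : ι} (h : T.Adj i j) :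
    nndist (x i) (x j) ≤ longestEdge x T := by
  classical
  have := Finset.le_sup (f := edgeLength x) (SimpleGraph.mem_edgeFinset.2 (T.mem_edgeSet.2 h))
  unfold longestEdge
  convert this
  rfl

theorem dist_le_two_mul_height (hT : T.Connected) (root v w : ι) :
    T.dist v w ≤ 2 * height T root := by
  have h : ∀ v, T.dist root v ≤ height T root := fun v =>
    Finset.le_sup (f := fun v => T.dist root v) (Finset.mem_univ v)
  calc T.dist v w ≤ T.dist v root + T.dist root w := hT.dist_triangle
    _ ≤ 2 * height T root := by
      rw [SimpleGraph.dist_comm]; linarith [h v, h w]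

theorem totalLength_mono {G G' : SimpleGraph ι} (h : G ≤ G') :
    totalLength x G ≤ totalLength x G' := by
  classical
  unfold totalLength
  exact Finset.sum_le_sum_of_subset (SimpleGraph.edgeFinset_mono h)

theorem totalLength_sup_edge_le (G : SimpleGraph ι) (a b : ι) :
    totalLength x (G ⊔ SimpleGraph.edge a b) ≤ totalLength x G + nndist (x a) (x b) := by
  classical
  have hsub : (G ⊔ SimpleGraph.edge a b).edgeFinset ⊆ insert s(a, b) G.edgeFinset := by
    intro e
    induction e using Sym2.ind with
    | _ u v =>
      simp only [SimpleGraph.mem_edgeFinset, SimpleGraph.mem_edgeSet, SimpleGraph.sup_adj,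
        SimpleGraph.edge_adj, Finset.mem_insert, Sym2.eq_iff]
      tauto
  calc totalLength x (G ⊔ SimpleGraph.edge a b)
      ≤ ∑ e ∈ insert s(a, b) G.edgeFinset, edgeLength x e := by
        unfold totalLength
        convert Finset.sum_le_sum_of_subset (f := edgeLength x) hsub
    _ ≤ edgeLength x s(a, b) + ∑ e ∈ G.edgeFinset, edgeLength x e := by
        by_cases h : s(a, b) ∈ G.edgeFinset
        · rw [Finset.insert_eq_self.2 h]; exact le_add_self
        · rw [Finset.sum_insert h]
    _ = totalLength x G + nndist (x a) (x b) := by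
        rw [add_comm]; unfold totalLength; congr

theorem totalLength_deleteEdges_add {G : SimpleGraph ι} {u v : ι} (h : G.Adj u v) :
    totalLength x (G.deleteEdges {s(u, v)}) + nndist (x u) (x v) = totalLength x G := by
  classical
  have hset : (G.deleteEdges {s(u, v)}).edgeFinset = G.edgeFinset.erase s(u, v) := by
    ext e
    simp [SimpleGraph.edgeSet_deleteEdges, and_comm]
  have := Finset.sum_erase_add G.edgeFinset (edgeLength x)
    (SimpleGraph.mem_edgeFinset.2 (G.mem_edgeSet.2 h))
  rw [← hset] at this
  unfold totalLength
  convert this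
  rfl

/-- The cut property of minimum spanning trees. -/
theorem IsMST.nndist_le_of_not_reachable (hT : IsMST x T) {u v a b : ι} (huv : T.Adj u v)
    (hab : ¬ (T.deleteEdges {s(u, v)}).Reachable a b) :
    nndist (x u) (x v) ≤ nndist (x a) (x b) := by
  -- The exchanged graph is connected; passing to a spanning tree inside it only lowers the length,
  -- so its acyclicity need not be checked.
  obtain ⟨T', hle, hT'⟩ := (connected_deleteEdges_sup_edge hT.1.1 hab).exists_isTree_le
  have h := (hT.2 T' hT').trans ((totalLength_mono x hle).trans (totalLength_sup_edge_le x _ a b))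
  rw [← totalLength_deleteEdges_add x huv] at h
  exact le_of_add_le_add_left h

theorem exists_adj_nndist_eq_longestEdge (h : 0 < longestEdge x T) :
    ∃ u v, T.Adj u v ∧ nndist (x u) (x v) = longestEdge x T := by
  classical
  have hne : T.edgeFinset.Nonempty := by
    by_contra hempty
    rw [Finset.not_nonempty_iff_eq_empty] at hempty
    refine h.ne' ?_
    unfold longestEdge
    convert Finset.sup_empty
    rfl
  obtain ⟨e, he, hmax⟩ := Finset.exists_mem_eq_sup _ hne (edgeLength x)
  induction e using Sym2.ind with
  | _ u v =>
    refine ⟨u, v, by simpa using he, ?_⟩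
    unfold longestEdge
    convert hmax.symm
    rfl

/-- Some set of points is at distance at least the longest edge from its nonempty complement. -/
theorem IsMST.exists_cut (hT : IsMST x T) (h : 0 < longestEdge x T) (r : ι) :
    ∃ V : Set ι, r ∈ V ∧ V ≠ Set.univ ∧
      ∀ a ∈ V, ∀ b ∉ V, longestEdge x T ≤ nndist (x a) (x b) := by
  obtain ⟨u, v, huv, hlen⟩ := exists_adj_nndist_eq_longestEdge x h
  -- The cut is the component of `r` after deletion of a longest edge, which is a bridge.
  refine ⟨{w | (T.deleteEdges {s(u, v)}).Reachable r w}, .rfl, fun huniv => ?_,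
    fun a ha b hb => ?_⟩
  · have hbridge := SimpleGraph.isAcyclic_iff_forall_adj_isBridge.1 hT.1.2 huv
    rw [SimpleGraph.isBridge_iff] at hbridge
    have hr : ∀ w, (T.deleteEdges {s(u, v)}).Reachable r w := fun w => by
      have : w ∈ {w | (T.deleteEdges {s(u, v)}).Reachable r w} := huniv ▸ Set.mem_univ w
      exact this
    exact hbridge ((hr u).symm.trans (hr v))
  · rw [← hlen]
    exact hT.nndist_le_of_not_reachable x huv fun hab => hb (SimpleGraph.Reachable.trans ha hab)

end Graph

/-! ### Lower bound for the optimum -/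

theorem IsMotion.dist_start_le {p : ℕ → Fin (σ.n + 1) → Plane} (hp : IsMotion σ p) (t : ℕ)
    (i : Fin (σ.n + 1)) : dist (σ.pos i) (p t i) ≤ t := by
  rw [← hp.start]
  induction t with
  | zero => simp
  | succ t ih =>
    push_cast
    exact (dist_triangle _ (p t i) _).trans (add_le_add ih (hp.speed t i))

/-- Robots awake only on one side of a cut need time to reach the other side. -/
theorem IsMotion.awakeAt_subset {p : ℕ → Fin (σ.n + 1) → Plane} (hp : IsMotion σ p) {M : ℝ}
    {V : Set (Fin (σ.n + 1))} (h0 : 0 ∈ V)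
    (hV : ∀ a ∈ V, ∀ b ∉ V, M ≤ dist (σ.pos a) (σ.pos b)) (t : ℕ) (ht : t + 1 < M) :
    awakeAt 0 p t ⊆ V ∧ ∀ b ∉ V, p t b = σ.pos b := by
  -- Robots in `V` have moved at most `t` and the others not at all, so the gap is at least `M - t >
  -- 1`.
  have hfar : ∀ t : ℕ, (t : ℝ) + 1 < M → (∀ b ∉ V, p t b = σ.pos b) →
      ∀ i ∈ V, ∀ j ∉ V, 1 < dist (p t i) (p t j) := by
    intro t ht hb i hi j hj
    have h1 := hV i hi j hj
    have h2 := dist_triangle (σ.pos i) (p t i) (σ.pos j)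
    have h3 := hp.dist_start_le σ t i
    rw [hb j hj]
    linarith
  induction t with
  | zero =>
    have hb : ∀ b ∉ V, p 0 b = σ.pos b := fun b _ => by rw [hp.start]
    exact ⟨awaken_subset (by simpa using h0) (hfar 0 ht hb), hb⟩
  | succ t ih =>
    push_cast at ht
    obtain ⟨h1, h2⟩ := ih (by linarith)
    have hb : ∀ b ∉ V, p (t + 1) b = σ.pos b := fun b hb => by
      rw [hp.asleep t b fun h => hb (h1 h), h2 b hb]
    exact ⟨awaken_subset h1 (hfar (t + 1) (by push_cast; linarith) hb), hb⟩

theorem longestEdge_le_two_mul_opt {T : SimpleGraph (Fin (σ.n + 1))} (hT : IsMST σ.pos T)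
    (hM : 1 < longestEdge σ.pos T) :
    ((longestEdge σ.pos T : ℝ≥0) : ℝ≥0∞) ≤ 2 * ((opt σ : ℕ∞) : ℝ≥0∞) := by
  obtain ⟨V, h0, hne, hV⟩ := hT.exists_cut σ.pos (zero_lt_one.trans hM) 0
  generalize longestEdge σ.pos T = M at *
  have hlow : ((⌈M / 2⌉₊ : ℕ) : ℕ∞) ≤ opt σ := by
    refine le_iInf₂ fun p hp => le_iInf₂ fun t ht => ?_
    have hlate : (M : ℝ) ≤ t + 1 := by
      by_contra! hlt
      have h := (hp.awakeAt_subset σ h0 (fun a ha b hb => by exact_mod_cast hV a ha b hb) t hlt).1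
      rw [ht] at h
      exact hne (Set.univ_subset_iff.1 h)
    have hM' : (1 : ℝ) < M := by exact_mod_cast hM
    -- Since `t ≥ 1`, the additive bound `M ≤ t + 1` becomes `M ≤ 2 * t`.
    have ht1 : 1 ≤ t := by
      by_contra! h
      obtain rfl : t = 0 := by omega
      norm_num at hlate
      exact absurd hlate hM.not_ge
    have ht1' : (1 : ℝ) ≤ t := by exact_mod_cast ht1
    have : M / 2 ≤ t := by
      rw [← NNReal.coe_le_coe]
      push_cast
      linarith
    exact_mod_cast Nat.ceil_le.2 this
  have hle : M ≤ 2 * (⌈M / 2⌉₊ : ℝ≥0) := by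
    have := Nat.le_ceil (M / 2)
    calc M = 2 * (M / 2) := by rw [mul_div_cancel₀]; norm_num
      _ ≤ _ := by gcongr
  calc (M : ℝ≥0∞) ≤ ((2 * (⌈M / 2⌉₊ : ℝ≥0) : ℝ≥0) : ℝ≥0∞) := by exact_mod_cast hle
    _ = 2 * (((⌈M / 2⌉₊ : ℕ) : ℕ∞) : ℝ≥0∞) := by simp
    _ ≤ 2 * ((opt σ : ℕ∞) : ℝ≥0∞) := by
      gcongr

/-! ### Upper bound for the spiral search -/

theorem cost_spiralSearch_le {T : SimpleGraph (Fin (σ.n + 1))} (hT : T.Connected)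
    (root : Fin (σ.n + 1)) (hM : 1 ≤ longestEdge σ.pos T) :
    spiralSearch.cost σ ≤
      ((2 * height T root * ⌊16 * (longestEdge σ.pos T : ℝ) ^ 2⌋₊ : ℕ) : ℕ∞) := by
  refine spiralSearch.cost_le σ fun w => ?_
  set N := ⌊16 * (longestEdge σ.pos T : ℝ) ^ 2⌋₊ with hN
  have hwalk : ∀ {v w : Fin (σ.n + 1)} (q : T.Walk v w) (t : ℕ),
      v ∈ (spiralSearch.run σ t).awake →
        w ∈ (spiralSearch.run σ (t + q.length * N)).awake := by
    intro v w q
    induction q with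
    | nil => intro t h; simpa using h
    | cons hadj q ih =>
      intro t h
      have hd : dist _ _ ≤ ((longestEdge σ.pos T : ℝ≥0) : ℝ) :=
        NNReal.coe_le_coe.2 (nndist_le_longestEdge σ.pos hadj)
      have := ih _ (spiralSearch_awakens σ (by exact_mod_cast hM) hN hd h)
      rw [SimpleGraph.Walk.length_cons]
      convert this using 3
      ring
  obtain ⟨q, hq⟩ := hT.exists_walk_length_eq_dist 0 w
  have h := hwalk q 0 (subset_awaken _ _ rfl)
  refine spiralSearch.run_awake_mono σ ?_ h
  rw [zero_add, hq]
  -- The factor `2` appears because the root need not be the leader.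
  exact Nat.mul_le_mul_right _ (dist_le_two_mul_height hT root 0 w)

theorem cost_eq_zero_of_longestEdge_le_one (A : OnlineAlgorithm) {T : SimpleGraph (Fin (σ.n + 1))}
    (hT : T.Connected) (hM : longestEdge σ.pos T ≤ 1) : A.cost σ = 0 := by
  have hwalk : ∀ {v w : Fin (σ.n + 1)}, T.Walk v w → v ∈ (A.run σ 0).awake →
      w ∈ (A.run σ 0).awake := by
    intro v w q
    induction q with
    | nil => exact id
    | cons hadj q ih =>
      exact fun h => ih (A.mem_run_awake_of_dist_le σ h
        (NNReal.coe_le_coe.2 ((nndist_le_longestEdge σ.pos hadj).trans hM)))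
  refine le_antisymm (A.cost_le σ (t := 0) fun w => ?_) zero_le
  obtain ⟨q⟩ := hT.preconnected 0 w
  exact hwalk q (subset_awaken _ _ rfl)

end ONFP

open ONFP in
theorem theorem1 :
    ∃ (A : ONFP.OnlineAlgorithm) (C : ℝ≥0),
      ∀ (σ : ONFP.Deployment) (T : SimpleGraph (Fin (σ.n + 1))) (root : Fin (σ.n + 1)),
        ONFP.IsMST σ.pos T →
          ∀ (M H : ℝ≥0), M = ONFP.longestEdge σ.pos T → H = (ONFP.height T root : ℝ≥0) →
            A.cost σ ≠ ⊤ ∧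
              ((A.cost σ : ℕ∞) : ℝ≥0∞) ≤
                ((C * (H * max M (NNReal.sqrt (M * H))) : ℝ≥0) : ℝ≥0∞) *
                  ((ONFP.opt σ : ℕ∞) : ℝ≥0∞) := by
  -- `64 = 2 * 16 * 2`: tree distance to the leader, spiral length, and `M ≤ 2 * opt`.
  refine ⟨spiralSearch, 64, ?_⟩
  rintro σ T root hT M H hMdef hHdef
  rcases le_or_gt (longestEdge σ.pos T) 1 with hM | hM
  · rw [cost_eq_zero_of_longestEdge_le_one σ _ hT.1.1 hM]
    simp
  have hcost := cost_spiralSearch_le σ hT.1.1 root hM.le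
  have hopt := longestEdge_le_two_mul_opt σ hT hM
  refine ⟨ne_top_of_le_ne_top (ENat.natCast_ne_top _) hcost, ?_⟩
  rw [← hMdef] at hcost hopt
  have hfloor : (⌊16 * (M : ℝ) ^ 2⌋₊ : ℝ≥0) ≤ 16 * M ^ 2 := by
    rw [← NNReal.coe_le_coe]
    push_cast
    exact Nat.floor_le (by positivity)
  calc ((spiralSearch.cost σ : ℕ∞) : ℝ≥0∞)
      ≤ (((2 * height T root * ⌊16 * (M : ℝ) ^ 2⌋₊ : ℕ) : ℕ∞) : ℝ≥0∞) :=
        ENat.toENNReal_le.2 hcost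
    _ = ((2 * H * (⌊16 * (M : ℝ) ^ 2⌋₊ : ℝ≥0) : ℝ≥0) : ℝ≥0∞) := by simp [hHdef]
    _ ≤ ((2 * H * (16 * M ^ 2) : ℝ≥0) : ℝ≥0∞) := by
        exact_mod_cast mul_le_mul_right hfloor (2 * H)
    _ = ((32 * (H * M) : ℝ≥0) : ℝ≥0∞) * (M : ℝ≥0∞) := by
        rw [← ENNReal.coe_mul]; congr 1; ring
    _ ≤ ((32 * (H * max M (NNReal.sqrt (M * H))) : ℝ≥0) : ℝ≥0∞) * (2 * ((opt σ : ℕ∞) : ℝ≥0∞)) := by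
        gcongr
        -- Only the branch `M` of the maximum is needed.
        exact le_max_left _ _
    _ = ((64 * (H * max M (NNReal.sqrt (M * H))) : ℝ≥0) : ℝ≥0∞) * ((opt σ : ℕ∞) : ℝ≥0∞) := by
        rw [← mul_assoc]
        congr 1
        push_cast
        ring
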